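/- Let $q=p^f$ be a prime power and let $\mathrm{A}\Gamma\mathrm{L}_1(q)$ be the group of all permutations $x\mapsto a\,\sigma(x)+b$ of the finite field $\mathbb{F}_q$, with $a\in\mathbb{F}_q^\ast$, $\sigma\in\mathrm{Aut}(\mathbb{F}_q)$ and $b\in\mathbb{F}_q$; let $V$ be its subgroup of translations $x\mapsto x+b$, identified with $\mathbb{F}_q$. Let $G\le \mathrm{A}\Gamma\mathrm{L}_1(q)$ be a subgroup that contains $V$ and acts primitively on $\mathbb{F}_q$, and let $H$ be the stabilizer in $G$ of the zero vector, so that $G=V\rtimes H$. Let $H^\ast$ be the set of all elements of $H$ that fix some nonzero vector of $\mathbb{F}_q$. For a finite group $X$, a normal $k$-covering of $X$ is a collection of $k$ proper subgroups of $X$ such that every element of $X$ is conjugate to an element of one of them, and the normal covering number $\gamma(X)$ is the smallest $k$ for which $X$ has a normal $k$-covering ($\gamma(X)=\infty$ if there is none, that is, if $X$ is cyclic). Suppose that $H$ is nilpotent and that $|H|>1$, and let $r$ be the largest prime dividing $|H|$. If $r>2$, then $r$ divides the index $|H:\langle H^\ast\rangle|$. In particular, $\gamma(G)=2$ and $G$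 is basic, that is: $\gamma(G)=2$ and $\gamma(G/N)\ne 2$ for every non-identity normal subgroup $N$ of $G$; and $G$ is basic of affine type, that is, $G$ has a unique minimal normal subgroup, this subgroup is abelian, the quotient of $G$ by it has normal covering number different from $2$, and $\gamma(G)=2$. -/

import Mathlib

section Covering

/-- `G` is the union of the conjugates of `k` proper subgroups: a normal `k`-covering. -/
def HasNormalCovering (G : Type*) [Group G] (k : ℕ) : Prop :=
  ∃ S : Fin k → Subgroup G, (∀ i, S i ≠ ⊤) ∧
    ∀ x : G, ∃ (i : Fin k) (g : G), g * x * g⁻¹ ∈ S i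

/-- The normal covering number `γ(G)`: the smallest `k` such that `G` has a normal `k`-covering,
and `⊤` if there is none (as for cyclic groups). -/
noncomputable def normalCoveringNumber (G : Type*) [Group G] : ℕ∞ :=
  sInf {n : ℕ∞ | ∃ k : ℕ, HasNormalCovering G k ∧ n = (k : ℕ∞)}

/-- `N` is a minimal normal subgroup of `G`. -/
def IsMinNormalSubgroup {G : Type*} [Group G] (N : Subgroup G) : Prop :=
  N.Normal ∧ N ≠ ⊥ ∧ ∀ M : Subgroup G, M.Normal → M ≤ N → M = ⊥ ∨ M = N

/-- `γ(G) = 2` and `γ(G/N) ≠ 2` for every non-identity normal subgroup `N`. -/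
def IsBasicGroup (G : Type*) [Group G] : Prop :=
  normalCoveringNumber G = 2 ∧
    ∀ (N : Subgroup G) [N.Normal], N ≠ ⊥ → normalCoveringNumber (G ⧸ N) ≠ 2

/-- `G` has a unique minimal normal subgroup `V`, `V` is abelian, `γ(G/V) ≠ 2`, `γ(G) = 2`. -/
def IsBasicGroupOfAffineType (G : Type*) [Group G] : Prop :=
  ∃ (V : Subgroup G) (_ : V.Normal),
    (∀ M : Subgroup G, IsMinNormalSubgroup M ↔ M = V) ∧
    (∀ x ∈ V, ∀ y ∈ V, x * y = y * x) ∧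
    normalCoveringNumber (G ⧸ V) ≠ 2 ∧
    normalCoveringNumber G = 2

end Covering

section AffineSemilinear

/-- The group `AΓL₁(F)` of all permutations `x ↦ a * σ x + b` of the field `F`, with `a ≠ 0`,
`σ` a field automorphism of `F` and `b ∈ F`. -/
def affineSemilinearGroup (F : Type*) [Field F] : Subgroup (Equiv.Perm F) where
  carrier := {g | ∃ (a : Fˣ) (σ : F ≃+* F) (b : F), ∀ x, g x = a * σ x + b}
  one_mem' := ⟨1, RingEquiv.refl F, 0, fun x => by simp⟩
  mul_mem' := by
    rintro g h ⟨a, σ, b, hg⟩ ⟨c, τ, d, hh⟩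
    refine ⟨a * Units.map (σ : F →* F) c, τ.trans σ, a * σ d + b, fun x => ?_⟩
    simp [hg, hh]
    ring
  inv_mem' := by
    rintro g ⟨a, σ, b, hg⟩
    refine ⟨Units.map (σ.symm : F →* F) a⁻¹, σ.symm, -σ.symm ((a⁻¹ : Fˣ) * b), fun x => ?_⟩
    rw [Equiv.Perm.inv_eq_iff_eq, hg]
    simp [mul_add]

/-- The group `V` of all translations `x ↦ x + b` of `F`. -/
def translationGroup (F : Type*) [Field F] : Subgroup (Equiv.Perm F) where
  carrier := {g | ∃ b : F, ∀ x, g x = x + b}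
  one_mem' := ⟨0, fun x => by simp⟩
  mul_mem' := by
    rintro g h ⟨b, hg⟩ ⟨d, hh⟩
    exact ⟨d + b, fun x => by simp [hg, hh, add_assoc]⟩
  inv_mem' := by
    rintro g ⟨b, hg⟩
    refine ⟨-b, fun x => ?_⟩
    rw [Equiv.Perm.inv_eq_iff_eq, hg]
    simp

/-- The stabilizer `H` in `G` of the zero vector. -/
abbrev zeroStabilizer {F : Type*} [Field F] (G : Subgroup (Equiv.Perm F)) : Subgroup G :=
  MulAction.stabilizer G (0 : F)

/-- The set `H*` of the elements of `H` that fix some nonzero vector. -/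
def fixingNonzero {F : Type*} [Field F] (G : Subgroup (Equiv.Perm F)) :
    Set (zeroStabilizer G) :=
  {h | ∃ v : F, v ≠ 0 ∧ h • v = v}

end AffineSemilinear

/-! ### Normal coverings with few components. -/

section NormalCoverings

/-! If `r` did not divide |H : ⟨H*⟩|, the Sylow `r`-subgroup R of H would lie in ⟨H*⟩. As H is
nilpotent, the projection `ρ` onto R is a power map, so it preserves H*, and R is generated by
elements fixing nonzero vectors. Let `lam` send a semilinear map to its field automorphism. Aut(F)
is cyclic, so one such generator x, fixing v say, has `lam x` generating `lam`(R). The norm of g • v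
/ v with respect to ⟨`lam x`⟩ is multiplicative in g and kills every generator of R (the easy half
of Hilbert 90); hence scalars in R have norm 1. If `lam x` has order r^(k+1), lifting the exponent
for odd r shows that z = x^(r^k) commutes with these scalars. So z is central in R, hence in H; it
fixes v, and irreducibility forces z = 1, a contradiction (`eq_bot_of_le_closure_fixing`).

Thus ⟨H*⟩ ≠ H. An element of G with a fixed point is conjugate into H; one without lies in V⟨H*⟩
(`hasNormalCovering_two`). Every nontrivial normal subgroup contains V, so proper quotients are
nilpotent. There maximal subgroups are normal, and no group is the union of two proper subgroups. -/

lemma not_hasNormalCovering_zero (G : Type*) [Group G] : ¬ HasNormalCovering G 0 := by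
  rintro ⟨S, -, h⟩
  exact (h 1).choose.elim0

/-- A finite group is not the union of the conjugates of a proper subgroup. -/
lemma Subgroup.eq_top_of_conj_mem {G : Type*} [Group G] [Finite G] (S : Subgroup G)
    (h : ∀ x : G, ∃ g : G, g * x * g⁻¹ ∈ S) : S = ⊤ := by
  classical
  have := Fintype.ofFinite G
  -- By transitivity the average number of fixed cosets is 1. Every element fixes at least one, so
  -- each fixes exactly one; but the identity fixes all.
  have burnside := MulAction.sum_card_fixedBy_eq_card_orbits_mul_card_group G (G ⧸ S)
  have horb : Fintype.card (Quotient (MulAction.orbitRel G (G ⧸ S))) = 1 := by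
    rw [Fintype.card_eq_one_iff_nonempty_unique]
    have := (MulAction.pretransitive_iff_subsingleton_quotient G (G ⧸ S)).1 inferInstance
    exact ⟨Unique.mk' _⟩
  rw [horb, one_mul] at burnside
  have hpos : ∀ x : G, 1 ≤ Fintype.card (MulAction.fixedBy (G ⧸ S) x) := by
    intro x
    obtain ⟨g, hg⟩ := h x
    rw [Nat.one_le_iff_ne_zero, ← Nat.pos_iff_ne_zero, Fintype.card_pos_iff]
    refine ⟨⟨((g⁻¹ : G) : G ⧸ S), ?_⟩⟩
    rw [MulAction.mem_fixedBy, MulAction.Quotient.smul_coe, eq_comm, QuotientGroup.eq]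
    simpa [mul_assoc] using hg
  have hone : Fintype.card (MulAction.fixedBy (G ⧸ S) (1 : G)) ≤ 1 := by
    by_contra! hlt
    have : ∑ _x : G, 1 < ∑ x : G, Fintype.card (MulAction.fixedBy (G ⧸ S) x) :=
      Finset.sum_lt_sum (fun x _ => hpos x) ⟨1, Finset.mem_univ _, hlt⟩
    simp only [Finset.sum_const, Finset.card_univ, smul_eq_mul, mul_one] at this
    omega
  rw [Fintype.card_le_one_iff] at hone
  rw [Subgroup.eq_top_iff']
  intro x
  have := hone ⟨(x : G ⧸ S), by simp⟩ ⟨((1 : G) : G ⧸ S), by simp⟩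
  rw [Subtype.mk.injEq, eq_comm, QuotientGroup.eq] at this
  simpa using this

lemma not_hasNormalCovering_one (G : Type*) [Group G] [Finite G] :
    ¬ HasNormalCovering G 1 := by
  rintro ⟨S, hS, h⟩
  refine hS 0 (Subgroup.eq_top_of_conj_mem _ fun x => ?_)
  obtain ⟨i, g, hg⟩ := h x
  exact ⟨g, by rwa [Subsingleton.elim 0 i]⟩

lemma normalCoveringNumber_eq_two {G : Type*} [Group G] [Finite G]
    (h : HasNormalCovering G 2) : normalCoveringNumber G = 2 := by
  refine le_antisymm (sInf_le ⟨2, h, rfl⟩) (le_sInf ?_)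
  rintro _ ⟨k, hk, rfl⟩
  have h0 : k ≠ 0 := by
    rintro rfl
    exact not_hasNormalCovering_zero G hk
  have h1 : k ≠ 1 := by
    rintro rfl
    exact not_hasNormalCovering_one G hk
  exact_mod_cast (by omega : 2 ≤ k)

lemma hasNormalCovering_of_normalCoveringNumber_eq_two {G : Type*} [Group G]
    (h : normalCoveringNumber G = 2) : HasNormalCovering G 2 := by
  have hne : {n : ℕ∞ | ∃ k : ℕ, HasNormalCovering G k ∧ n = (k : ℕ∞)}.Nonempty := by
    rw [Set.nonempty_iff_ne_empty]
    intro he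
    rw [normalCoveringNumber, he, sInf_empty] at h
    exact absurd h (by decide)
  obtain ⟨k, hk, hk2⟩ := csInf_mem hne
  rw [← normalCoveringNumber, h] at hk2
  have : k = 2 := by exact_mod_cast hk2.symm
  rwa [← this]

/-- A proper subgroup of a finite nilpotent group lies in a proper normal subgroup. -/
lemma Subgroup.exists_normal_ge_of_isNilpotent {X : Type*} [Group X] [Finite X]
    [Group.IsNilpotent X] (S : Subgroup X) (hS : S ≠ ⊤) :
    ∃ M : Subgroup X, M.Normal ∧ M ≠ ⊤ ∧ S ≤ M := by
  obtain h | ⟨M, hM, hSM⟩ := eq_top_or_exists_le_coatom S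
  · exact absurd h hS
  · exact ⟨M, Subgroup.NormalizerCondition.normal_of_coatom M
      Group.normalizerCondition_of_isNilpotent hM, hM.1, hSM⟩

/-- A finite nilpotent group does not have normal covering number two. -/
lemma normalCoveringNumber_ne_two_of_isNilpotent (X : Type*) [Group X] [Finite X]
    [Group.IsNilpotent X] : normalCoveringNumber X ≠ 2 := by
  intro h
  obtain ⟨S, hS, hcov⟩ := hasNormalCovering_of_normalCoveringNumber_eq_two h
  choose M hMn hMt hSM using fun i => (S i).exists_normal_ge_of_isNilpotent (hS i)
  have hmem : ∀ x : X, x ∈ M 0 ∨ x ∈ M 1 := by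
    intro x
    obtain ⟨i, g, hg⟩ := hcov x
    have := (hMn i).conj_mem _ (hSM i hg) g⁻¹
    have hx : x ∈ M i := by simpa [mul_assoc] using this
    fin_cases i
    · exact .inl hx
    · exact .inr hx
  obtain ⟨a, ha⟩ : ∃ a, a ∉ M 0 := by
    by_contra! hall
    exact hMt 0 ((Subgroup.eq_top_iff' _).2 hall)
  obtain ⟨b, hb⟩ : ∃ b, b ∉ M 1 := by
    by_contra! hall
    exact hMt 1 ((Subgroup.eq_top_iff' _).2 hall)
  have ha1 := (hmem a).resolve_left ha
  have hb0 := (hmem b).resolve_right hb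
  rcases hmem (a * b) with hab | hab
  · exact ha ((Subgroup.mul_mem_cancel_right _ hb0).1 hab)
  · exact hb ((Subgroup.mul_mem_cancel_left _ ha1).1 hab)

end NormalCoverings

/-! ### Nilpotent groups and their primary components. -/

section PrimaryProjection

/-- In a finite nilpotent group, the projection onto the Sylow `r`-subgroup is a power map. -/
lemma Group.IsNilpotent.exists_pow_primary_projection {H : Type*} [Group H] [Finite H]
    (hnil : Group.IsNilpotent H) {r : ℕ} (hr : r.Prime) :
    ∃ (N : ℕ) (ρ : H →* H), (∀ x, ρ x = x ^ N) ∧ (∀ x, ∃ k : ℕ, ρ x ^ r ^ k = 1) ∧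
      ∀ x, ∀ k : ℕ, x ^ r ^ k = 1 → ρ x = x := by
  have hc : Nat.card H ≠ 0 := Nat.card_pos.ne'
  set c := Nat.card H with hcdef
  set e := c.factorization r with he
  have hcop : Nat.Coprime (r ^ e) (c / r ^ e) := Nat.Coprime.pow_left _ (Nat.coprime_ordCompl hr hc)
  -- With this exponent, the power map is the identity on the Sylow `r`-subgroup and trivial on the
  -- other Sylow factors, hence multiplicative on their product.
  obtain ⟨N, hN1, hN0⟩ := Nat.chineseRemainder hcop 1 0
  have hN0 : c / r ^ e ∣ N := (Nat.modEq_zero_iff_dvd).1 hN0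
  have hmul : r ^ e * (c / r ^ e) = c := Nat.ordProj_mul_ordCompl_eq_self c r
  have hfix : ∀ {K : Type _} [Group K] (x : K), x ^ r ^ e = 1 → x ^ N = x := by
    intro K _ x hx
    have := pow_eq_pow_iff_modEq.2 (hN1.of_dvd (orderOf_dvd_of_pow_eq_one hx))
    rwa [pow_one] at this
  have hpk : ∀ x : H, ∀ k : ℕ, x ^ r ^ k = 1 → x ^ r ^ e = 1 := by
    intro x k hx
    obtain ⟨j, -, hj⟩ := (Nat.dvd_prime_pow hr).1 (orderOf_dvd_of_pow_eq_one hx)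
    have hd : orderOf x ∣ c := orderOf_dvd_natCard x
    rw [← orderOf_dvd_iff_pow_eq_one, hj]
    rw [hj] at hd
    exact pow_dvd_pow _ ((hr.pow_dvd_iff_le_factorization hc).1 hd)
  have htfae := (Group.isNilpotent_of_finite_tfae (G := H)).out 0 4
  obtain ⟨φ⟩ := htfae.1 hnil
  have hpi : ∀ u v : (∀ p : (Nat.card H).primeFactors, ∀ P : Sylow p H, P),
      (u * v) ^ N = u ^ N * v ^ N := by
    intro u v
    funext p P
    simp only [Pi.pow_apply, Pi.mul_apply]
    have hp : (p : ℕ).Prime := Nat.prime_of_mem_primeFactors p.2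
    have hcard : ∀ w : P, ∃ k : ℕ, orderOf w = (p : ℕ) ^ k := fun w => by
      have := Fact.mk hp
      exact (IsPGroup.iff_orderOf.1 P.2) w
    by_cases hpr : (p : ℕ) = r
    · have hx : ∀ w : P, w ^ N = w := by
        intro w
        apply hfix
        obtain ⟨k, hk⟩ := hcard w
        replace hk : orderOf w = r ^ k := hk.trans (by rw [hpr])
        have h1 : (w : H) ^ r ^ k = 1 := by
          rw [← hk]
          exact_mod_cast pow_orderOf_eq_one w
        exact_mod_cast hpk _ _ h1
      simp only [hx]
    · have hx : ∀ w : P, w ^ N = 1 := by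
        intro w
        obtain ⟨k, hk⟩ := hcard w
        rw [← orderOf_dvd_iff_pow_eq_one]
        refine dvd_trans ?_ hN0
        have h1 : orderOf w ∣ c := by
          rw [← Subgroup.orderOf_coe]
          exact orderOf_dvd_natCard _
        rw [← hmul] at h1
        refine Nat.Coprime.dvd_of_dvd_mul_left ?_ h1
        rw [hk]
        exact ((Nat.coprime_primes hp hr).2 hpr).pow _ _
      simp only [hx, mul_one]
  have hhom : ∀ x y : H, (x * y) ^ N = x ^ N * y ^ N := by
    intro x y
    apply φ.symm.injective
    simpa using hpi (φ.symm x) (φ.symm y)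
  refine ⟨N, MonoidHom.mk' (fun x => x ^ N) hhom, fun x => rfl, fun x => ⟨e, ?_⟩,
    fun x k hx => hfix x (hpk x k hx)⟩
  change (x ^ N) ^ r ^ e = 1
  rw [← pow_mul, ← orderOf_dvd_iff_pow_eq_one]
  refine (orderOf_dvd_natCard x).trans ?_
  rw [← hcdef, ← hmul, mul_comm]
  exact mul_dvd_mul_right hN0 _

/-- If the endomorphism `ρ` of a group is a power map, then an element fixed
by `ρ` and commuting with the image of `ρ` is central. -/
lemma commute_of_forall_commute_pow {H : Type*} [Group H] {N : ℕ} {ρ : H →* H}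
    (hρ : ∀ x, ρ x = x ^ N) {z : H} (hz : ρ z = z) (hcomm : ∀ x, Commute z (ρ x)) (h : H) :
    Commute z h := by
  -- The conjugate is evaluated twice: power maps commute with conjugation, and `ρ` is a
  -- homomorphism.
  have h1 : ρ (h * z⁻¹ * h⁻¹) = h * z⁻¹ * h⁻¹ := by
    rw [hρ, conj_pow, ← hρ, map_inv, hz]
  have h2 : ρ (h * z⁻¹ * h⁻¹) = z⁻¹ := by
    rw [map_mul, map_mul, map_inv, map_inv, hz, ← (hcomm h).inv_left.eq]
    simp
  have h3 : h * z⁻¹ * h⁻¹ = z⁻¹ := h1.symm.trans h2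
  have h4 : Commute h z⁻¹ := mul_inv_eq_iff_eq_mul.1 h3
  simpa using h4.symm.inv_left

/-- A cyclic `r`-group generated by a set is generated by a member of this set. -/
lemma IsCyclic.exists_mem_zpowers_of_closure {C : Type*} [Group C] [Finite C] [IsCyclic C] {r : ℕ}
    (hr : r.Prime) {T : Set C} (hT : T.Nonempty) (hTr : ∀ t ∈ T, ∃ k : ℕ, t ^ r ^ k = 1) :
    ∃ t ∈ T, Subgroup.closure T ≤ Subgroup.zpowers t := by
  classical
  have := Fintype.ofFinite C
  obtain ⟨t, ht, hmax⟩ := Set.exists_max_image T orderOf T.toFinite hT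
  refine ⟨t, ht, ?_⟩
  rw [Subgroup.closure_le]
  intro y hy
  have hdvd : orderOf y ∣ orderOf t := by
    obtain ⟨k, hk⟩ := hTr y hy
    obtain ⟨l, hl⟩ := hTr t ht
    obtain ⟨i, -, hi⟩ := (Nat.dvd_prime_pow hr).1 (orderOf_dvd_of_pow_eq_one hk)
    obtain ⟨j, -, hj⟩ := (Nat.dvd_prime_pow hr).1 (orderOf_dvd_of_pow_eq_one hl)
    have := hmax y hy
    rw [hi, hj] at this ⊢
    exact pow_dvd_pow _ ((Nat.pow_le_pow_iff_right hr.one_lt).1 this)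
  have hsub : (Subgroup.zpowers t : Set C).toFinset ⊆
      Finset.univ.filter (fun a : C => a ^ orderOf t = 1) := by
    intro a ha
    rw [Set.mem_toFinset, SetLike.mem_coe, Subgroup.mem_zpowers_iff] at ha
    obtain ⟨n, rfl⟩ := ha
    simp only [Finset.mem_filter, Finset.mem_univ, true_and]
    rw [← zpow_natCast, zpow_comm, zpow_natCast, pow_orderOf_eq_one, one_zpow]
  -- A cyclic group has at most n solutions of a^n = 1, so the powers of `t` exhaust them for n =
  -- `orderOf t`.
  have heq := Finset.eq_of_subset_of_card_le hsub (by
    refine (IsCyclic.card_pow_eq_one_le (orderOf_pos t)).trans ?_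
    rw [Set.toFinset_card, ← Nat.card_eq_fintype_card]
    exact (Nat.card_zpowers t).ge)
  have : y ∈ (Subgroup.zpowers t : Set C).toFinset := by
    rw [heq]
    simpa using orderOf_dvd_iff_pow_eq_one.1 hdvd
  simpa using this

end PrimaryProjection

/-! ### Valuations of geometric sums. -/

section LiftingTheExponent

/-- If the odd prime `r` divides `Q - 1`, then the `r`-part of `1 + Q + ⋯ + Q ^ (r ^ (k + 1) - 1)`
divides `Q ^ r ^ k - 1`. -/
lemma Nat.pow_dvd_pow_sub_one_of_dvd_geom_sum {r Q k m : ℕ} (hr : r.Prime) (hr2 : 2 < r)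
    (hQ : 1 < Q) (hdvd : r ∣ Q - 1) (h : r ^ m ∣ ∑ i ∈ Finset.range (r ^ (k + 1)), Q ^ i) :
    r ^ m ∣ Q ^ r ^ k - 1 := by
  have := Fact.mk hr
  have hodd : Odd r := hr.odd_of_ne_two (by omega)
  have hrQ : ¬ r ∣ Q := fun hrQ => hr.one_lt.ne' (Nat.dvd_one.1 (by
    have := Nat.dvd_sub hrQ hdvd
    rwa [Nat.sub_sub_self hQ.le] at this))
  have lte : ∀ n, padicValNat r (Q ^ r ^ n - 1) = padicValNat r (Q - 1) + n := by
    intro n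
    have := padicValNat.pow_sub_pow hodd hQ hdvd hrQ (pow_ne_zero n hr.ne_zero)
    rwa [one_pow, padicValNat.prime_pow] at this
  have hmul : (∑ i ∈ Finset.range (r ^ (k + 1)), Q ^ i) * (Q - 1) = Q ^ r ^ (k + 1) - 1 := by
    have := geom_sum_mul_add (Q - 1) (r ^ (k + 1))
    rw [Nat.sub_add_cancel hQ.le] at this
    omega
  have hpow : ∀ n, 1 < Q ^ r ^ n := fun n => Nat.one_lt_pow (pow_ne_zero n hr.ne_zero) hQ
  have hE : (∑ i ∈ Finset.range (r ^ (k + 1)), Q ^ i) ≠ 0 := by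
    intro h0
    rw [h0, zero_mul] at hmul
    have := hpow (k + 1)
    omega
  have hval := lte (k + 1)
  rw [← hmul, padicValNat.mul hE (by omega)] at hval
  rw [padicValNat_dvd_iff_le hE] at h
  rw [padicValNat_dvd_iff_le (by have := hpow k; omega), lte k]
  -- The sum has valuation exactly k + 1, so m ≤ k + 1 ≤ v_r(Q - 1) + k.
  have h1 := one_le_padicValNat_of_dvd (by omega) hdvd
  omega

end LiftingTheExponent

/-! ### Automorphisms of finite fields as Frobenius powers. -/

section FiniteFieldAutomorphisms

lemma RingAut.exists_surjective_gal (F : Type*) [Field F] [Finite F] (p : ℕ) [Algebra (ZMod p) F] :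
    ∃ f : Gal(F/ZMod p) →* RingAut F, Function.Surjective f ∧ ∀ e x, f e x = e x := by
  refine ⟨⟨⟨fun e => e.toRingEquiv, rfl⟩, fun _ _ => rfl⟩, fun σ => ?_, fun _ _ => rfl⟩
  refine ⟨AlgEquiv.ofRingEquiv (f := σ) fun c => ?_, ?_⟩
  · exact RingHom.congr_fun
      (Subsingleton.elim ((σ : F →+* F).comp (algebraMap (ZMod p) F)) (algebraMap (ZMod p) F)) c
  · ext x
    rfl

lemma RingAut.isCyclic_of_finite_field (F : Type*) [Field F] [Finite F] :
    IsCyclic (RingAut F) := by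
  obtain ⟨p, hp⟩ := CharP.exists F
  have : Fact p.Prime := ⟨(CharP.char_is_prime_or_zero F p).resolve_right
    (CharP.char_ne_zero_of_finite F p)⟩
  let _ := ZMod.algebra F p
  obtain ⟨f, hf, -⟩ := RingAut.exists_surjective_gal F p
  exact isCyclic_of_surjective f hf

lemma RingAut.exists_eq_pow {F : Type*} [Field F] [Finite F] (σ : RingAut F) :
    ∃ Q : ℕ, 0 < Q ∧ ∀ x, σ x = x ^ Q := by
  obtain ⟨p, hp⟩ := CharP.exists F
  have : Fact p.Prime := ⟨(CharP.char_is_prime_or_zero F p).resolve_right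
    (CharP.char_ne_zero_of_finite F p)⟩
  let _ := ZMod.algebra F p
  obtain ⟨f, hf, hfe⟩ := RingAut.exists_surjective_gal F p
  obtain ⟨e, rfl⟩ := hf σ
  obtain ⟨n, rfl⟩ := (FiniteField.bijective_frobeniusAlgEquivOfAlgebraic_pow (ZMod p) F).2 e
  refine ⟨Fintype.card (ZMod p) ^ n.1, pow_pos Fintype.card_pos _, fun x => ?_⟩
  rw [hfe, AlgEquiv.coe_pow, FiniteField.coe_frobeniusAlgEquivOfAlgebraic_iterate]

instance RingAut.finite_of_finite_field (F : Type*) [Field F] [Finite F] : Finite (RingAut F) :=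
  Finite.of_injective (fun σ : RingAut F => (σ : F → F)) DFunLike.coe_injective

end FiniteFieldAutomorphisms

/-! ### Semilinear actions, scalars and irreducibility. -/

section SemilinearAction

/-- The action of `H` on the field `F` is by maps `x ↦ a * σ x`. -/
def IsSemilinearAction (H F : Type*) [Group H] [Field F] [MulAction H F] : Prop :=
  ∀ h : H, ∃ (a : Fˣ) (σ : F ≃+* F), ∀ x : F, h • x = a * σ x

variable {H F : Type*} [Group H] [Field F] [MulAction H F]

/-- The scalar factor is the value at 1; comparing factors of `g * h` gives a cocycle identity, and
cancelling it leaves multiplicativity of the automorphisms. -/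
lemma IsSemilinearAction.exists_hom (hsl : IsSemilinearAction H F) :
    ∃ lam : H →* RingAut F, ∀ (h : H) (x : F), h • x = (h • (1 : F)) * lam h x := by
  choose a σ hσ using hsl
  have ha : ∀ h : H, h • (1 : F) = a h := fun h => by simp [hσ]
  refine ⟨MonoidHom.mk' (fun h => (σ h : RingAut F)) fun g h => ?_, fun h x => by
    rw [ha]; exact hσ h x⟩
  ext x
  have h1 : (g * h) • x = g • h • x := mul_smul _ _ _
  have h2 : (a (g * h) : F) = a g * σ g (a h) := by
    rw [← ha, mul_smul, ha h, hσ]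
  rw [hσ, hσ h, hσ g, h2, map_mul, ← mul_assoc] at h1
  refine mul_left_cancel₀ ?_ h1
  exact mul_ne_zero (Units.ne_zero _) (by simp)

lemma IsSemilinearAction.smul_zero (hsl : IsSemilinearAction H F) (h : H) :
    h • (0 : F) = 0 := by
  obtain ⟨a, σ, hσ⟩ := hsl h
  simp [hσ]

lemma IsSemilinearAction.smul_add (hsl : IsSemilinearAction H F) (h : H) (x y : F) :
    h • (x + y) = h • x + h • y := by
  obtain ⟨a, σ, hσ⟩ := hsl h
  simp [hσ, mul_add]

lemma IsSemilinearAction.smul_ne_zero (hsl : IsSemilinearAction H F) (h : H) {x : F}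
    (hx : x ≠ 0) : h • x ≠ 0 := by
  obtain ⟨a, σ, hσ⟩ := hsl h
  simp [hσ, hx]

/-- A central element fixing a nonzero vector of an irreducible module acts trivially. -/
lemma IsSemilinearAction.eq_one_of_central [FaithfulSMul H F] (hsl : IsSemilinearAction H F)
    (hirr : ∀ W : AddSubgroup F, (∀ (h : H), ∀ x ∈ W, h • x ∈ W) → W = ⊥ ∨ W = ⊤)
    {z : H} (hz : ∀ h, Commute z h) {v : F} (hv : v ≠ 0) (hzv : z • v = v) : z = 1 := by
  -- The fixed points of `z` form an invariant subgroup because `z` is central.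
  have key := hirr
    { carrier := {x | z • x = x}
      zero_mem' := hsl.smul_zero z
      add_mem' := fun {x y} hx hy => by
        rw [Set.mem_ofPred_eq] at hx hy ⊢
        rw [hsl.smul_add, hx, hy]
      neg_mem' := fun {x} hx => by
        rw [Set.mem_ofPred_eq] at hx ⊢
        have h0 := hsl.smul_add z x (-x)
        rw [add_neg_cancel, hsl.smul_zero, hx] at h0
        exact (neg_eq_of_add_eq_zero_right h0.symm).symm }
    (fun h x (hx : z • x = x) => by
      change z • h • x = h • x
      rw [← mul_smul, (hz h).eq, mul_smul, hx])
  rcases key with h | h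
  · have hmem : v ∈ (⊥ : AddSubgroup F) := by
      rw [← h]
      exact hzv
    exact absurd (AddSubgroup.mem_bot.1 hmem) hv
  · refine eq_of_smul_eq_smul (α := F) fun x => ?_
    have hmem : x ∈ (⊤ : AddSubgroup F) := AddSubgroup.mem_top x
    rw [← h] at hmem
    rw [one_smul]
    exact hmem

/-- The elements which act by scalars and lie in a given subgroup form a cyclic group. -/
lemma exists_generator_of_scalars [FaithfulSMul H F] [Finite H] {lam : H →* RingAut F}
    (hlam : ∀ (h : H) (x : F), h • x = (h • (1 : F)) * lam h x)
    (R : Subgroup H) :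
    ∃ g ∈ R ⊓ lam.ker, ∀ c ∈ R ⊓ lam.ker, c ∈ Subgroup.zpowers g := by
  let f : (R ⊓ lam.ker : Subgroup H) →* F :=
    { toFun := fun c => (c : H) • (1 : F)
      map_one' := one_smul _ _
      map_mul' := fun c d => by
        have hc : lam c = 1 := c.2.2
        rw [Subgroup.coe_mul, mul_smul, hlam c (_ • _), hc]
        rfl }
  have hf : Function.Injective f := by
    intro c d hcd
    have hc : lam c = 1 := c.2.2
    have hd : lam d = 1 := d.2.2
    apply Subtype.ext
    refine eq_of_smul_eq_smul (α := F) fun x => ?_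
    rw [hlam c, hlam d, hc, hd]
    exact congrArg (· * x) hcd
  have := isCyclic_of_injective_ringHom f hf
  obtain ⟨g, hg⟩ := IsCyclic.exists_generator (α := (R ⊓ lam.ker : Subgroup H))
  refine ⟨g, g.2, fun c hc => ?_⟩
  obtain ⟨n, hn⟩ := Subgroup.mem_zpowers_iff.1 (hg ⟨c, hc⟩)
  exact Subgroup.mem_zpowers_iff.2 ⟨n, by simpa using congrArg Subtype.val hn⟩

end SemilinearAction

/-! ### The odd Sylow subgroups and the elements fixing nonzero vectors. -/

section FixingElements

variable {H F : Type*} [Group H] [Field F] [MulAction H F]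

/-- If the closure of a normal set `T` has index prime to `r`, then the image of an endomorphism
`ρ` with `r`-elements as values is generated by elements of `T`, provided that `ρ` maps `T` to
itself. -/
lemma mem_closure_of_not_dvd_index {H : Type*} [Group H] {r : ℕ} (hr : r.Prime)
    {T : Set H} (hconj : ∀ g, ∀ t ∈ T, g * t * g⁻¹ ∈ T)
    (hind : ¬ r ∣ (Subgroup.closure T).index) {ρ : H →* H}
    (hρr : ∀ x, ∃ k : ℕ, ρ x ^ r ^ k = 1) (hρT : ∀ t ∈ T, ρ t ∈ T) {g : H} (hg : ρ g = g) :
    g ∈ Subgroup.closure {h | h ∈ ρ.range ∧ h ∈ T} := by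
  have hn : (Subgroup.closure T).Normal := by
    refine ⟨fun t ht g => ?_⟩
    have h1 := Subgroup.mem_map_of_mem (MulAut.conj g).toMonoidHom ht
    rw [MonoidHom.map_closure] at h1
    refine Subgroup.closure_mono ?_ h1
    rintro _ ⟨t, ht, rfl⟩
    exact hconj g t ht
  have hgT : g ∈ Subgroup.closure T := by
    obtain ⟨k, hk⟩ := hρr g
    rw [hg] at hk
    have h1 := Subgroup.pow_index_mem (Subgroup.closure T) g
    have hcop : Nat.Coprime (Subgroup.closure T).index (r ^ k) :=
      ((Nat.Prime.coprime_iff_not_dvd hr).2 hind).symm.pow_right _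
    have h2 : g ^ (Nat.gcd (Subgroup.closure T).index (r ^ k) : ℤ) ∈ Subgroup.closure T := by
      rw [Nat.gcd_eq_gcd_ab, zpow_add, zpow_mul, zpow_mul, zpow_natCast, zpow_natCast, hk,
        one_zpow, mul_one]
      exact Subgroup.zpow_mem _ h1 _
    rw [hcop] at h2
    simpa using h2
  have h3 : ρ g ∈ (Subgroup.closure T).map ρ := Subgroup.mem_map_of_mem ρ hgT
  rw [MonoidHom.map_closure, hg] at h3
  refine Subgroup.closure_mono ?_ h3
  rintro _ ⟨t, ht, rfl⟩
  exact ⟨⟨t, rfl⟩, hρT t ht⟩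

lemma eq_one_of_scalar_of_fixing [FaithfulSMul H F] {lam : H →* RingAut F}
    (hlam : ∀ (h : H) (x : F), h • x = (h • (1 : F)) * lam h x) {g : H} (hg : lam g = 1)
    {w : F} (hw : w ≠ 0) (hgw : g • w = w) : g = 1 := by
  rw [hlam, hg, RingAut.one_apply] at hgw
  have h1 : g • (1 : F) = 1 := by
    simpa [hw] using hgw
  refine eq_of_smul_eq_smul (α := F) fun x => ?_
  rw [hlam, hg, h1, RingAut.one_apply, one_mul, one_smul]

lemma RingAut.pow_apply_eq_pow {F : Type*} [Field F] {σ : RingAut F} {Q : ℕ}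
    (hQ : ∀ x, σ x = x ^ Q) (n : ℕ) (x : F) : (σ ^ n) x = x ^ Q ^ n := by
  induction n generalizing x with
  | zero => simp
  | succ n ih => rw [pow_succ, RingAut.mul_apply, hQ, ih, ← pow_mul, pow_succ, mul_comm]

/-- The norm map `u ↦ u ^ (1 + Q + ⋯ + Q ^ (s - 1))` is invariant under the powers of the
automorphism `u ↦ u ^ Q` of order dividing `s`. -/
lemma RingAut.pow_geom_sum_apply {F : Type*} [Field F] {σ : RingAut F} {Q s : ℕ}
    (hQ : ∀ x, σ x = x ^ Q) (hs : σ ^ s = 1) (n : ℕ) {u : F} (hu : u ≠ 0) :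
    ((σ ^ n) u) ^ (∑ i ∈ Finset.range s, Q ^ i) = u ^ (∑ i ∈ Finset.range s, Q ^ i) := by
  have hbase : ∀ u : F, u ≠ 0 →
      (σ u) ^ (∑ i ∈ Finset.range s, Q ^ i) = u ^ (∑ i ∈ Finset.range s, Q ^ i) := by
    intro u hu
    have h1 : u ^ Q ^ s = u := by
      rw [← RingAut.pow_apply_eq_pow hQ, hs, RingAut.one_apply]
    have h2 : Q * (∑ i ∈ Finset.range s, Q ^ i) + 1 = Q ^ s + ∑ i ∈ Finset.range s, Q ^ i := by
      rw [← geom_sum_succ, ← geom_sum_succ']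
    have h3 := congrArg (u ^ ·) h2
    simp only [pow_add, pow_one, h1] at h3
    rw [hQ, ← pow_mul]
    exact mul_right_cancel₀ hu (h3.trans (mul_comm _ _))
  induction n with
  | zero => simp
  | succ n ih => rw [pow_succ', RingAut.mul_apply, hbase _ ((map_ne_zero_iff _ (σ ^ n).injective).2 hu), ih]

/-- Let `R` be an `r`-subgroup of a group acting faithfully and irreducibly on a finite field by
semilinear maps, such that every element centralizing `R` and lying in `R` is central. If `r` is
odd and `R` is generated by elements which fix nonzero vectors, then `R` is trivial. -/
lemma eq_bot_of_le_closure_fixing [Finite H] [Finite F] [FaithfulSMul H F]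
    (hsl : IsSemilinearAction H F)
    (hirr : ∀ W : AddSubgroup F, (∀ (h : H), ∀ x ∈ W, h • x ∈ W) → W = ⊥ ∨ W = ⊤)
    {r : ℕ} (hr : r.Prime) (hr2 : 2 < r) {R : Subgroup H} (hR : ∀ g ∈ R, ∃ k : ℕ, g ^ r ^ k = 1)
    (hcen : ∀ z ∈ R, (∀ g ∈ R, Commute z g) → ∀ h, Commute z h)
    (hgen : R ≤ Subgroup.closure {h : H | h ∈ R ∧ ∃ v : F, v ≠ 0 ∧ h • v = v}) : R = ⊥ := by
  obtain ⟨lam, hlam⟩ := hsl.exists_hom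
  set T := {h : H | h ∈ R ∧ ∃ v : F, v ≠ 0 ∧ h • v = v} with hT
  have := RingAut.isCyclic_of_finite_field F
  -- The generator of `lam`(R) can be taken from `lam`(T), so it lifts to an element fixing a vector
  -- `v`.
  obtain ⟨_, ⟨x, ⟨hxR, v, hv, hxv⟩, rfl⟩, hx⟩ :=
    IsCyclic.exists_mem_zpowers_of_closure hr (T := lam '' T)
      ⟨_, 1, ⟨R.one_mem, 1, one_ne_zero, one_smul _ _⟩, rfl⟩ (by
        rintro _ ⟨t, ht, rfl⟩
        obtain ⟨k, hk⟩ := hR t ht.1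
        exact ⟨k, by rw [← map_pow, hk, map_one]⟩)
  have hlamR : ∀ g ∈ R, ∃ n : ℕ, lam g = lam x ^ n := by
    intro g hg
    have h1 := hx (by
      rw [← MonoidHom.map_closure]
      exact Subgroup.mem_map_of_mem lam (hgen hg))
    rw [← mem_powers_iff_mem_zpowers] at h1
    obtain ⟨n, hn⟩ := h1
    exact ⟨n, hn.symm⟩
  obtain ⟨k, hk⟩ : ∃ k, orderOf (lam x) = r ^ k := by
    obtain ⟨j, hj⟩ := hR x hxR
    obtain ⟨k, -, hk⟩ := (Nat.dvd_prime_pow hr).1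
      (orderOf_dvd_of_pow_eq_one (show lam x ^ r ^ j = 1 by rw [← map_pow, hj, map_one]))
    exact ⟨k, hk⟩
  cases k with
  | zero =>
    have hx1 : lam x = 1 := by simpa using hk
    rw [eq_bot_iff]
    refine hgen.trans ((Subgroup.closure_le _).2 ?_)
    rintro g ⟨hgR, w, hw, hgw⟩
    obtain ⟨n, hn⟩ := hlamR g hgR
    exact eq_one_of_scalar_of_fixing hlam (by rw [hn, hx1, one_pow]) hw hgw
  | succ k =>
    exfalso
    obtain ⟨Q, hQ0, hQ⟩ := RingAut.exists_eq_pow (lam x)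
    obtain ⟨g₀, hg₀, hgen₀⟩ := exists_generator_of_scalars hlam R
    have hlg₀ : lam g₀ = 1 := hg₀.2
    set a : F := g₀ • (1 : F) with ha
    have ha0 : a ≠ 0 := hsl.smul_ne_zero g₀ one_ne_zero
    have hg₀s : ∀ y : F, g₀ • y = a * y := fun y => by
      rw [hlam, hlg₀, RingAut.one_apply]
    have hs : lam x ^ r ^ (k + 1) = 1 := by rw [← hk, pow_orderOf_eq_one]
    set E := ∑ i ∈ Finset.range (r ^ (k + 1)), Q ^ i with hE
    have hnorm : ∀ g ∈ R, ∀ u : F, u ≠ 0 → (lam g u) ^ E = u ^ E := by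
      intro g hg u hu
      obtain ⟨n, hn⟩ := hlamR g hg
      rw [hn]
      exact RingAut.pow_geom_sum_apply hQ hs n hu
    -- The cocycle g • v / v becomes a homomorphism after raising to the power `E`, by `hnorm`. If g
    -- fixes w, it is the coboundary of v / w, of norm 1.
    have hphi : ∀ g ∈ Subgroup.closure T, g ∈ R ∧ (g • v / v) ^ E = 1 := by
      intro g hg
      induction hg using Subgroup.closure_induction with
      | mem g hg =>
        obtain ⟨hgR, w, hw, hgw⟩ := hg
        refine ⟨hgR, ?_⟩
        have hlw : lam g w ≠ 0 := by simpa using hw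
        have h1 : g • v / v = lam g (v / w) / (v / w) := by
          rw [hlam] at hgw ⊢
          rw [map_div₀]
          field_simp
          linear_combination (lam g v) * hgw
        have hvw : v / w ≠ 0 := div_ne_zero hv hw
        rw [h1, div_pow, hnorm g hgR _ hvw, div_self (pow_ne_zero _ hvw)]
      | one => exact ⟨R.one_mem, by rw [one_smul, div_self hv, one_pow]⟩
      | mul g h _ _ hg hh =>
        refine ⟨R.mul_mem hg.1 hh.1, ?_⟩
        have hhv : h • v / v ≠ 0 := div_ne_zero (hsl.smul_ne_zero h hv) hv
        have h1 : (g * h) • v / v = lam g (h • v / v) * (g • v / v) := by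
          rw [mul_smul, hlam g, hlam g v, map_div₀]
          have : lam g v ≠ 0 := by simpa using hv
          field_simp
        rw [h1, mul_pow, hnorm g hg.1 _ hhv, hg.2, hh.2, one_mul]
      | inv g _ hg =>
        refine ⟨R.inv_mem hg.1, ?_⟩
        have hhv : g⁻¹ • v / v ≠ 0 := div_ne_zero (hsl.smul_ne_zero _ hv) hv
        have h1 : lam g (g⁻¹ • v / v) * (g • v / v) = 1 := by
          have h2 : g • g⁻¹ • v = v := smul_inv_smul g v
          rw [hlam g] at h2
          rw [hlam g v, map_div₀]
          have : lam g v ≠ 0 := by simpa using hv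
          field_simp
          linear_combination h2
        have h3 := congrArg (· ^ E) h1
        simp only [mul_pow, hnorm g hg.1 _ hhv, hg.2, mul_one, one_pow] at h3
        exact h3
    have haE : a ^ E = 1 := by
      have h1 := (hphi g₀ (hgen hg₀.1)).2
      rwa [hg₀s, mul_div_assoc, div_self hv, mul_one] at h1
    have hx1 : lam x ^ r ^ k ≠ 1 := by
      intro h1
      have h2 := orderOf_dvd_of_pow_eq_one h1
      rw [hk] at h2
      have := (Nat.pow_dvd_pow_iff_le_right hr.one_lt).1 h2
      omega
    have hQ1 : 1 < Q := by
      by_contra hle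
      obtain rfl : Q = 1 := by omega
      have : lam x = 1 := by
        ext y
        rw [hQ, pow_one, RingAut.one_apply]
      exact hx1 (by rw [this, one_pow])
    obtain ⟨m, hm⟩ : ∃ m, orderOf a = r ^ m := by
      obtain ⟨j, hj⟩ := hR g₀ hg₀.1
      have hpow : ∀ n : ℕ, g₀ ^ n • (1 : F) = a ^ n := by
        intro n
        induction n with
        | zero => simp
        | succ n ih => rw [pow_succ', mul_smul, ih, hg₀s, pow_succ']
      obtain ⟨m, -, hm⟩ := (Nat.dvd_prime_pow hr).1
        (orderOf_dvd_of_pow_eq_one (show a ^ r ^ j = 1 by rw [← hpow, hj, one_smul]))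
      exact ⟨m, hm⟩
    have hdvd : r ^ m ∣ Q ^ r ^ k - 1 := by
      -- Only for m > 0 must `r` divide Q - 1: then `r` divides the order of `a`, so Q^(r^(k+1)) ≡ 1
      -- mod `r`, and Fermat reduces the left side to Q.
      rcases Nat.eq_zero_or_pos m with rfl | hmpos
      · simp
      · refine Nat.pow_dvd_pow_sub_one_of_dvd_geom_sum hr hr2 hQ1 ?_ ?_
        · have h1 : a ^ Q ^ r ^ (k + 1) = a ^ 1 := by
            rw [← RingAut.pow_apply_eq_pow hQ, hs, RingAut.one_apply, pow_one]
          have h2 : Q ^ r ^ (k + 1) ≡ 1 [MOD r] := by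
            have hfin : IsOfFinOrder a := orderOf_pos_iff.1 (hm ▸ pow_pos hr.pos m)
            refine (hfin.pow_eq_pow_iff_modEq.1 h1).of_dvd ?_
            rw [hm]
            exact dvd_pow_self r hmpos.ne'
          have h3 : (Q : ZMod r) = 1 := by
            have := Fact.mk hr
            have h4 := (ZMod.natCast_eq_natCast_iff _ _ _).2 h2
            rw [Nat.cast_pow, ZMod.pow_card_pow, Nat.cast_one] at h4
            exact h4
          refine (Nat.modEq_iff_dvd' hQ1.le).1 ?_
          rw [← ZMod.natCast_eq_natCast_iff, h3, Nat.cast_one]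
        · rw [← hm]
          exact orderOf_dvd_of_pow_eq_one haE
    have hza : (lam x ^ r ^ k) a = a := by
      rw [RingAut.pow_apply_eq_pow hQ]
      rw [← hm, orderOf_dvd_iff_pow_eq_one] at hdvd
      have h1 : Q ^ r ^ k = (Q ^ r ^ k - 1) + 1 :=
        (Nat.sub_add_cancel (Nat.one_le_pow _ _ hQ0)).symm
      rw [h1, pow_succ, hdvd, one_mul]
    have hzg₀ : Commute (x ^ r ^ k) g₀ := by
      refine eq_of_smul_eq_smul (α := F) fun y => ?_
      rw [mul_smul, mul_smul, hg₀s, hg₀s, hlam _ (a * y), hlam _ y, map_mul, map_pow, hza]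
      ring
    -- R is generated by `x` and the scalar `g₀`.
    have hzR : ∀ g ∈ R, Commute (x ^ r ^ k) g := by
      intro g hg
      obtain ⟨n, hn⟩ := hlamR g hg
      have hmem : g * (x ^ n)⁻¹ ∈ R ⊓ lam.ker :=
        ⟨R.mul_mem hg (R.inv_mem (R.pow_mem hxR n)), by
          change lam _ = 1
          rw [map_mul, map_inv, map_pow, hn, mul_inv_cancel]⟩
      obtain ⟨i, hi⟩ := Subgroup.mem_zpowers_iff.1 (hgen₀ _ hmem)
      rw [← inv_mul_cancel_right g (x ^ n), ← hi]
      exact (hzg₀.zpow_right i).mul_right (Commute.pow_pow_self x _ _)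
    have hzv : x ^ r ^ k • v = v := by
      have : ∀ n : ℕ, x ^ n • v = v := by
        intro n
        induction n with
        | zero => simp
        | succ n ih => rw [pow_succ, mul_smul, hxv, ih]
      exact this _
    have hz1 := hsl.eq_one_of_central hirr (hcen _ (R.pow_mem hxR _) hzR) hv hzv
    exact hx1 (by rw [← map_pow, hz1, map_one])

/-- Let a finite nilpotent group act faithfully and irreducibly on a finite field by semilinear
maps. Every odd prime divisor of its order divides the index of the subgroup generated by the
elements which fix a nonzero vector. -/
lemma dvd_index_closure_fixing [Finite H] [Finite F] [FaithfulSMul H F]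
    (hnil : Group.IsNilpotent H) (hsl : IsSemilinearAction H F)
    (hirr : ∀ W : AddSubgroup F, (∀ (h : H), ∀ x ∈ W, h • x ∈ W) → W = ⊥ ∨ W = ⊤)
    {r : ℕ} (hr : r.Prime) (hr2 : 2 < r) (hdvd : r ∣ Nat.card H) :
    r ∣ (Subgroup.closure {h : H | ∃ v : F, v ≠ 0 ∧ h • v = v}).index := by
  by_contra hind
  obtain ⟨N, ρ, hρ, hρr, hρid⟩ := hnil.exists_pow_primary_projection hr
  have hfix : ∀ g ∈ ρ.range, ρ g = g := by
    rintro _ ⟨g, rfl⟩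
    obtain ⟨k, hk⟩ := hρr g
    exact hρid _ k hk
  have hbot : ρ.range = ⊥ := by
    refine eq_bot_of_le_closure_fixing hsl hirr hr hr2 ?_ ?_ ?_
    · rintro _ ⟨g, rfl⟩
      exact hρr g
    · intro z hz hcomm
      exact commute_of_forall_commute_pow hρ (hfix z hz) fun x => hcomm _ ⟨x, rfl⟩
    · intro g hg
      refine mem_closure_of_not_dvd_index hr ?_ hind hρr ?_ (hfix g hg)
      · rintro g t ⟨v, hv, htv⟩
        refine ⟨g • v, hsl.smul_ne_zero g hv, ?_⟩
        rw [mul_smul, mul_smul, inv_smul_smul, htv]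
      · rintro t ⟨v, hv, htv⟩
        refine ⟨v, hv, ?_⟩
        rw [hρ]
        generalize N = n
        induction n with
        | zero => simp
        | succ n ih => rw [pow_succ, mul_smul, htv, ih]
  have := Fact.mk hr
  -- Cauchy's theorem gives an element of order `r`, which `ρ` fixes, against `hbot`.
  obtain ⟨g, hg⟩ := exists_prime_orderOf_dvd_card' r hdvd
  have hg1 : ρ g = g := hρid g 1 (by rw [pow_one, ← hg, pow_orderOf_eq_one])
  have hmem : g ∈ ρ.range := ⟨g, hg1⟩
  rw [hbot, Subgroup.mem_bot] at hmem
  rw [hmem, orderOf_one] at hg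
  exact hr.one_lt.ne hg

end FixingElements

/-! ### Primitive affine groups, their normal subgroups and the covering. -/

section AffineGroups

variable {F : Type*} [Field F]

lemma addRight_mem_translationGroup (b : F) : Equiv.addRight b ∈ translationGroup F :=
  ⟨b, fun _ => rfl⟩

/-- The translation `x ↦ x + b` as an element of a group containing all translations. -/
def translation {G : Subgroup (Equiv.Perm F)} (hV : translationGroup F ≤ G) (b : F) : G :=
  ⟨Equiv.addRight b, hV (addRight_mem_translationGroup b)⟩

variable {G : Subgroup (Equiv.Perm F)}

@[simp]
lemma translation_smul (hV : translationGroup F ≤ G) (b x : F) :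
    translation hV b • x = x + b := rfl

lemma mem_translationGroup_subgroupOf {g : G} :
    g ∈ (translationGroup F).subgroupOf G ↔ ∃ b : F, ∀ x : F, g • x = x + b := Iff.rfl

lemma exists_smul_eq (hG : G ≤ affineSemilinearGroup F) (g : G) :
    ∃ (a : Fˣ) (σ : F ≃+* F) (b : F), ∀ x : F, g • x = a * σ x + b := hG g.2

lemma isSemilinearAction_zeroStabilizer (hG : G ≤ affineSemilinearGroup F) :
    IsSemilinearAction (zeroStabilizer G) F := by
  intro h
  obtain ⟨a, σ, b, hg⟩ := exists_smul_eq hG h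
  have hb : b = 0 := by
    have h0 : (h : G) • (0 : F) = 0 := h.2
    simpa [hg] using h0
  refine ⟨a, σ, fun x => ?_⟩
  change (h : G) • x = _
  rw [hg, hb, add_zero]

/-- The linear part of `g ∈ G`, an element of the stabilizer of zero. -/
def linearPart (hV : translationGroup F ≤ G) (g : G) : zeroStabilizer G :=
  ⟨translation hV (-(g • (0 : F))) * g, by
    rw [MulAction.mem_stabilizer_iff, mul_smul, translation_smul, add_neg_cancel]⟩

lemma linearPart_smul (hV : translationGroup F ≤ G) (g : G) (x : F) :
    linearPart hV g • x = g • x - g • (0 : F) := by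
  change (translation hV (-(g • (0 : F))) * g) • x = _
  rw [mul_smul, translation_smul, sub_eq_add_neg]

lemma translation_mul_linearPart (hV : translationGroup F ≤ G) (g : G) :
    translation hV (g • (0 : F)) * (linearPart hV g : G) = g := by
  refine eq_of_smul_eq_smul (α := F) fun x => ?_
  have h1 := linearPart_smul hV g x
  rw [mul_smul, translation_smul]
  change linearPart hV g • x + _ = _
  rw [h1, sub_add_cancel]

lemma smul_add_eq (hG : G ≤ affineSemilinearGroup F) (hV : translationGroup F ≤ G) (g : G)
    (x y : F) : g • (x + y) = g • x + linearPart hV g • y := by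
  obtain ⟨a, σ, b, hg⟩ := exists_smul_eq hG g
  rw [linearPart_smul]
  simp only [hg, map_add, map_zero]
  ring

/-- The translations by the elements of an additive subgroup `W`. -/
def translationsBy (G : Subgroup (Equiv.Perm F)) (W : AddSubgroup F) : Subgroup G where
  carrier := {g | ∃ b ∈ W, ∀ x : F, g • x = x + b}
  one_mem' := ⟨0, W.zero_mem, fun x => by simp⟩
  mul_mem' := by
    rintro g h ⟨b, hb, hg⟩ ⟨d, hd, hh⟩
    exact ⟨d + b, W.add_mem hd hb, fun x => by rw [mul_smul, hh, hg, add_assoc]⟩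
  inv_mem' := by
    rintro g ⟨b, hb, hg⟩
    refine ⟨-b, W.neg_mem hb, fun x => ?_⟩
    rw [inv_smul_eq_iff, hg, neg_add_cancel_right]

lemma normal_translationsBy (hG : G ≤ affineSemilinearGroup F) (hV : translationGroup F ≤ G)
    {W : AddSubgroup F} (hW : ∀ (h : zeroStabilizer G), ∀ x ∈ W, h • x ∈ W) :
    (translationsBy G W).Normal := by
  refine ⟨?_⟩
  rintro t ⟨b, hb, ht⟩ g
  refine ⟨linearPart hV g • b, hW _ b hb, fun x => ?_⟩
  rw [mul_smul, mul_smul, ht, smul_add_eq hG hV, smul_inv_smul]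

lemma translationsBy_top :
    translationsBy G ⊤ = (translationGroup F).subgroupOf G := by
  ext g
  exact ⟨fun ⟨b, _, h⟩ => ⟨b, h⟩, fun ⟨b, h⟩ => ⟨b, trivial, h⟩⟩

lemma normal_translationGroup (hG : G ≤ affineSemilinearGroup F) (hV : translationGroup F ≤ G) :
    ((translationGroup F).subgroupOf G).Normal := by
  rw [← translationsBy_top]
  exact normal_translationsBy hG hV fun _ _ _ => trivial

/-- A nontrivial normal subgroup of a primitive permutation group is transitive. -/
lemma exists_smul_eq_of_normal {X : Type*} {G : Subgroup (Equiv.Perm X)}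
    (hprim : MulAction.IsPreprimitive G X) {N : Subgroup G}
    (hN : N.Normal) (hne : N ≠ ⊥) (x y : X) : ∃ n ∈ N, n • x = y := by
  have htrans : MulAction.IsPretransitive N X := by
    refine MulAction.IsQuasiPreprimitive.isPretransitive_of_normal (G := G) fun hfix => hne ?_
    rw [eq_bot_iff]
    intro n hn
    refine eq_of_smul_eq_smul (α := X) fun z => ?_
    have hz : z ∈ MulAction.fixedPoints N X := hfix ▸ Set.mem_univ z
    rw [one_smul]
    exact hz ⟨n, hn⟩
  obtain ⟨n, hn⟩ := htrans.exists_smul_eq x y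
  exact ⟨n, n.2, hn⟩

/-- The translations by an invariant `W` form a normal subgroup of a primitive group; if nontrivial
it is transitive, and the orbit of 0 is `W`. -/
lemma irreducible_zeroStabilizer (hG : G ≤ affineSemilinearGroup F)
    (hV : translationGroup F ≤ G) (hprim : MulAction.IsPreprimitive G F) (W : AddSubgroup F)
    (hW : ∀ (h : zeroStabilizer G), ∀ x ∈ W, h • x ∈ W) : W = ⊥ ∨ W = ⊤ := by
  by_cases hne : translationsBy G W = ⊥
  · left
    rw [eq_bot_iff]
    intro b hb
    have hmem : translation hV b ∈ translationsBy G W := ⟨b, hb, fun _ => rfl⟩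
    rw [hne, Subgroup.mem_bot] at hmem
    have := congrArg (· • (0 : F)) hmem
    simpa using this
  · right
    rw [eq_top_iff]
    intro y _
    obtain ⟨n, ⟨b, hb, hn⟩, hny⟩ := exists_smul_eq_of_normal hprim
      (normal_translationsBy hG hV hW) hne 0 y
    rw [hn, zero_add] at hny
    rwa [← hny]

lemma commute_of_mem_translationGroup {s t : G} (hs : s ∈ (translationGroup F).subgroupOf G)
    (ht : t ∈ (translationGroup F).subgroupOf G) : s * t = t * s := by
  obtain ⟨b, hb⟩ := mem_translationGroup_subgroupOf.1 hs
  obtain ⟨d, hd⟩ := mem_translationGroup_subgroupOf.1 ht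
  refine eq_of_smul_eq_smul (α := F) fun x => ?_
  rw [mul_smul, mul_smul, hb, hd, hd, hb, add_right_comm]

/-- A permutation commuting with all translations is a translation. -/
lemma mem_translationGroup_of_forall_commute (hV : translationGroup F ≤ G) {n : G}
    (h : ∀ b : F, Commute n (translation hV b)) : n ∈ (translationGroup F).subgroupOf G := by
  refine mem_translationGroup_subgroupOf.2 ⟨n • (0 : F), fun x => ?_⟩
  have := congrArg (· • (0 : F)) (h x).eq
  simpa [mul_smul, add_comm] using this

lemma translationGroup_ne_bot (hV : translationGroup F ≤ G) :
    (translationGroup F).subgroupOf G ≠ ⊥ := by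
  intro h
  have hmem : translation hV 1 ∈ (translationGroup F).subgroupOf G := ⟨1, fun _ => rfl⟩
  rw [h, Subgroup.mem_bot] at hmem
  have := congrArg (· • (0 : F)) hmem
  simp at this

/-- A nontrivial normal subgroup contains all translations. -/
lemma translationGroup_le_of_normal (hG : G ≤ affineSemilinearGroup F)
    (hV : translationGroup F ≤ G) (hprim : MulAction.IsPreprimitive G F) {N : Subgroup G}
    (hN : N.Normal) (hne : N ≠ ⊥) : (translationGroup F).subgroupOf G ≤ N := by
  set V := (translationGroup F).subgroupOf G with hVdef
  have hVn : V.Normal := normal_translationGroup hG hV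
  -- If the intersection were trivial, `N` would centralize V; but V is its own centralizer.
  have hmeet : N ⊓ V ≠ ⊥ := by
    intro hbot
    apply hne
    rw [eq_bot_iff]
    intro n hn
    have hnV : n ∈ V := mem_translationGroup_of_forall_commute hV fun b =>
      Subgroup.commute_of_normal_of_disjoint N V hN hVn (disjoint_iff.2 hbot) n _ hn
        (addRight_mem_translationGroup b)
    rw [← hbot]
    exact ⟨hn, hnV⟩
  intro t ht
  obtain ⟨b, hb⟩ := mem_translationGroup_subgroupOf.1 ht
  obtain ⟨n, ⟨hnN, hnV⟩, hn⟩ := exists_smul_eq_of_normal hprim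
    (inferInstance : (N ⊓ V).Normal) hmeet 0 b
  obtain ⟨d, hd⟩ := mem_translationGroup_subgroupOf.1 hnV
  have htn : t = n := by
    refine eq_of_smul_eq_smul (α := F) fun x => ?_
    rw [hd, zero_add] at hn
    rw [hb, hd, hn]
  rwa [htn]

/-- A proper quotient of `G` is nilpotent if the stabilizer of zero is. -/
lemma isNilpotent_quotient (hV : translationGroup F ≤ G)
    (hnil : Group.IsNilpotent (zeroStabilizer G)) (N : Subgroup G) [N.Normal]
    (hVN : (translationGroup F).subgroupOf G ≤ N) : Group.IsNilpotent (G ⧸ N) := by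
  refine Group.nilpotent_of_surjective ((QuotientGroup.mk' N).comp (zeroStabilizer G).subtype) ?_
  intro q
  obtain ⟨g, rfl⟩ := QuotientGroup.mk'_surjective N q
  refine ⟨linearPart hV g, ?_⟩
  conv_rhs => rw [← translation_mul_linearPart hV g, map_mul]
  have h1 : QuotientGroup.mk' N (translation hV (g • (0 : F))) = 1 := by
    rw [QuotientGroup.mk'_apply, QuotientGroup.eq_one_iff]
    exact hVN (addRight_mem_translationGroup _)
  rw [h1, one_mul]
  rfl

/-- If the elements fixing a nonzero vector generate a proper subgroup `K` of the stabilizer `H`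
of zero, then every element of `G` is conjugate to an element of `H` or of `VK`. -/
lemma hasNormalCovering_two [Finite F] (hG : G ≤ affineSemilinearGroup F)
    (hV : translationGroup F ≤ G) (hne : Subgroup.closure (fixingNonzero G) ≠ ⊤) :
    HasNormalCovering G 2 := by
  set V := (translationGroup F).subgroupOf G with hVdef
  have hVn : V.Normal := normal_translationGroup hG hV
  set K := (Subgroup.closure (fixingNonzero G)).map (zeroStabilizer G).subtype with hK
  refine ⟨![zeroStabilizer G, V ⊔ K], ?_, fun g => ?_⟩
  · intro i
    fin_cases i
    · intro (htop : zeroStabilizer G = ⊤)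
      have hmem : translation hV 1 ∈ zeroStabilizer G := htop ▸ Subgroup.mem_top _
      rw [MulAction.mem_stabilizer_iff] at hmem
      simp at hmem
    · intro (htop : V ⊔ K = ⊤)
      refine hne ((Subgroup.eq_top_iff' _).2 fun h => ?_)
      have hmem : (h : G) ∈ V ⊔ K := htop ▸ Subgroup.mem_top _
      rw [Subgroup.mem_sup_of_normal_left] at hmem
      obtain ⟨t, ht, _, ⟨l, hl, rfl⟩, hmul⟩ := hmem
      obtain ⟨b, hb⟩ := mem_translationGroup_subgroupOf.1 ht
      have h0 : b = 0 := by
        have hh0 : (h : G) • (0 : F) = 0 := h.2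
        have hl0 : (l : G) • (0 : F) = 0 := l.2
        rw [← hmul, mul_smul, Subgroup.subtype_apply, hl0, hb, zero_add] at hh0
        exact hh0
      have ht1 : t = 1 := by
        refine eq_of_smul_eq_smul (α := F) fun x => ?_
        rw [hb, h0, add_zero, one_smul]
      rw [ht1, one_mul] at hmul
      have : l = h := Subtype.ext hmul
      rwa [← this]
  · by_cases hfix : ∃ w : F, g • w = w
    · obtain ⟨w, hw⟩ := hfix
      refine ⟨0, translation hV (-w), ?_⟩
      change _ ∈ zeroStabilizer G
      have hinv : (translation hV (-w))⁻¹ • (0 : F) = w := by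
        rw [inv_smul_eq_iff, translation_smul, add_neg_cancel]
      rw [MulAction.mem_stabilizer_iff, mul_smul, mul_smul, hinv, hw, translation_smul,
        add_neg_cancel]
    · push Not at hfix
      refine ⟨1, 1, ?_⟩
      change _ ∈ V ⊔ K
      rw [one_mul, inv_one, mul_one, ← translation_mul_linearPart hV g]
      refine Subgroup.mul_mem_sup (addRight_mem_translationGroup _)
        (Subgroup.mem_map_of_mem (zeroStabilizer G).subtype
          (Subgroup.subset_closure (show linearPart hV g ∈ fixingNonzero G from ?_)))
      by_contra hnot
      have hsl := isSemilinearAction_zeroStabilizer hG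
      -- If the linear part h fixes no nonzero vector, h - 1 is injective, hence onto by finiteness;
      -- solving (h - 1)w = -g • 0 gives a fixed point of g.
      have hinj : Function.Injective (fun y : F => linearPart hV g • y - y) := by
        intro y y' hyy
        by_contra hne'
        refine hnot ⟨y - y', sub_ne_zero.2 hne', ?_⟩
        have h1 := hsl.smul_add (linearPart hV g) (y - y') y'
        rw [sub_add_cancel] at h1
        simp only at hyy
        linear_combination hyy - h1
      obtain ⟨w, hw⟩ := Finite.surjective_of_injective hinj (-(g • (0 : F)))
      simp only [linearPart_smul] at hw
      exact hfix w (by linear_combination hw)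

end AffineGroups

theorem theorem3 {F : Type*} [Field F] [Finite F]
    (G : Subgroup (Equiv.Perm F))
    (hG : G ≤ affineSemilinearGroup F)
    (hV : translationGroup F ≤ G)
    (hprim : MulAction.IsPreprimitive G F)
    (hnil : Group.IsNilpotent (zeroStabilizer G))
    (r : ℕ)
    (hr : IsGreatest {s : ℕ | s.Prime ∧ s ∣ Nat.card (zeroStabilizer G)} r)
    (hr2 : 2 < r) :
    r ∣ (Subgroup.closure (fixingNonzero G)).index ∧
      normalCoveringNumber G = 2 ∧
      IsBasicGroup G ∧
      IsBasicGroupOfAffineType G := by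
  obtain ⟨⟨hrp, hrd⟩, -⟩ := hr
  have hindex : r ∣ (Subgroup.closure (fixingNonzero G)).index :=
    dvd_index_closure_fixing hnil (isSemilinearAction_zeroStabilizer hG)
      (irreducible_zeroStabilizer hG hV hprim) hrp hr2 hrd
  have hne : Subgroup.closure (fixingNonzero G) ≠ ⊤ := by
    intro htop
    rw [htop, Subgroup.index_top] at hindex
    exact hrp.one_lt.ne' (Nat.dvd_one.1 hindex)
  have htwo : normalCoveringNumber G = 2 :=
    normalCoveringNumber_eq_two (hasNormalCovering_two hG hV hne)
  have hquot : ∀ (N : Subgroup G) [N.Normal], N ≠ ⊥ → normalCoveringNumber (G ⧸ N) ≠ 2 := by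
    intro N hN hNe
    have := isNilpotent_quotient hV hnil N (translationGroup_le_of_normal hG hV hprim hN hNe)
    exact normalCoveringNumber_ne_two_of_isNilpotent _
  have hVn := normal_translationGroup hG hV
  have hVb := translationGroup_ne_bot hV
  refine ⟨hindex, htwo, ⟨htwo, hquot⟩, (translationGroup F).subgroupOf G, hVn, fun M => ?_,
    fun x hx y hy => commute_of_mem_translationGroup hx hy, hquot _ hVb, htwo⟩
  constructor
  · rintro ⟨hMn, hMb, hmin⟩
    exact ((hmin _ hVn (translationGroup_le_of_normal hG hV hprim hMn hMb)).resolve_left hVb).symm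
  · rintro rfl
    refine ⟨hVn, hVb, fun M hMn hMV => ?_⟩
    by_cases hMb : M = ⊥
    · exact .inl hMb
    · exact .inr (le_antisymm hMV (translationGroup_le_of_normal hG hV hprim hMn hMb))
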